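/- **Setting.** An LQO system $\mathcal S=(A,B,C,(M_j)_{j=1}^p)$ is $x_k=Ax_{k-1}+Bu_k$, $y_k=Cx_k+M(x_k\otimes x_k)$ with $A\in\mathbb C^{n\times n}$, $B\in\mathbb C^{n\times m}$, $C\in\mathbb C^{p\times n}$, $M_j\in\mathbb C^{n\times n}$, $M=[\mathrm{vec}(M_1),\dots,\mathrm{vec}(M_p)]^\top$. Its Volterra kernels are $h_1[t]=CA^tB$ and $h_2[t_1,t_2]=M(A^{t_1}B\otimes A^{t_2}B)$. For a horizon $L$, with Frobenius norms, $\|h_1\|_{\ell^2_L}^2=\sum_{t<L}\|h_1[t]\|^2$, $\|h_2\|_{\ell^2_L}^2=\sum_{t_1,t_2<L}\|h_2[t_1,t_2]\|^2$, and $\|\mathcal S-\hat{\mathcal S}\|_{h^2_L}^2=\|h_1-\hat h_1\|_{\ell^2_L}^2+\|h_2-\hat h_2\|_{\ell^2_L}^2$ (the state dimensions may differ). A square matrix is stable if all its eigenvalues lie in the open unit disk. A $\xi$-layer Deep SSM has in layer $i=1,\dots,\xi$ an LQO system $\mathcal S^{(i)}$ with $p=m$, a stable diagonal $A^{(i)}=\mathrm{diag}(\Lambda^{(i)})$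 and $M^{(i)}_j=(U^{(i)}_j)^*U^{(i)}_j$, followed by the layer normalization $\mathrm{LN}^{(i)}(z)=\gamma_1^{(i)}\odot\frac{z-\mu}{\sigma}+\gamma_2^{(i)}$ on $\mathbb R^m$, where $\mu=\frac1m\sum_a z_a$, $\sigma=\sqrt{\frac1m\sum_a(z_a-\mu)^2+\varepsilon}$, $\varepsilon>0$. Let $b$ be a constant, $\omega=\max_i\mathrm{Lip}(\mathrm{LN}^{(i)})$, $\tilde g_j=1+\sqrt L\,(\|h_1^{(j)}\|_{\ell^2_L}+2b\|h_2^{(j)}\|_{\ell^2_L})$ and $\tilde G_i=\omega^{\xi-i+1}\prod_{j=i+1}^{\xi}\tilde g_j$. The reduced system of layer $i$ is $\hat{\mathcal S}^{(i)}=(\hat A^{(i)},\hat B^{(i)},\hat C^{(i)},(\hat M^{(i)}_j)_{j=1}^m)$ of state dimension $r_i$, and the objective, a function of the parameters $(\hat\Lambda^{(i)},\hat B^{(i)},\hat C^{(i)},(\hat M_j^{(i)})_j)_{i}$ with $\hat A^{(i)}=\mathrm{diag}(\hat\Lambda^{(i)})$, is $$f=\sum_{i=1}^{\xi}\tilde G_i\,\|\mathcal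 S^{(i)}-\hat{\mathcal S}^{(i)}\|_{h^2_L}.$$ Put $\varphi^{(i)}=\|\mathcal S^{(i)}-\hat{\mathcal S}^{(i)}\|^2_{h^2_L}$ as a function of $(\hat A^{(i)},\hat B^{(i)},\hat C^{(i)},(\hat M_j^{(i)})_j)$, with $\hat A^{(i)}$ an arbitrary square matrix, and $K_i=2\sqrt{\varphi^{(i)}}$. Gradients of real-valued functions are taken with respect to $\langle X,Y\rangle=\mathrm{Re}\,\mathrm{tr}(X^*Y)$: $F$ is (real) Fréchet differentiable in all the variables $\theta_1,\theta_2,\dots$ jointly and $\mathrm dF=\sum_j\langle\nabla_{\theta_j}F,\mathrm d\theta_j\rangle$. All complex entries, also those of $\hat M_j^{(i)}$, are independent variables. **Theorem.** Consider a point at which every $\hat A^{(i)}=\mathrm{diag}(\hat\Lambda^{(i)})$ is stable and every $\hat M_j^{(i)}$ is Hermitian. (1) Each $\varphi^{(i)}$ has gradients there. (2) If $\varphi^{(i)}\neq0$ at the point, then $f$, as a function of the parameters of layer $i$ with the other layers fixed, has the gradients $$\nabla_{\hat\Lambda^{(i)}}f=\frac{\tilde G_i}{K_i}\,\mathrm{diag}\big(\nabla_{\hat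 A^{(i)}}\varphi^{(i)}\big),\quad \nabla_{\hat B^{(i)}}f=\frac{\tilde G_i}{K_i}\nabla_{\hat B^{(i)}}\varphi^{(i)},\quad \nabla_{\hat C^{(i)}}f=\frac{\tilde G_i}{K_i}\nabla_{\hat C^{(i)}}\varphi^{(i)},\quad \nabla_{\hat M_j^{(i)}}f=\frac{\tilde G_i}{K_i}\nabla_{\hat M_j^{(i)}}\varphi^{(i)}\quad(1\le j\le m),$$ where $\mathrm{diag}$ of a matrix is its diagonal. If $\varphi^{(i)}\ne0$ for all $i$, these are the gradients of $f$ as a function of all the parameters jointly. (3) The gradients of $\varphi=\varphi^{(i)}$ at the point are, dropping the index $i$, $$\begin{aligned}\nabla_{\hat A}\varphi&=2\big(-(\tilde Y_L+2\tilde Z_L)^*A\tilde P_L+(\hat Y_L+2\hat Z_L)\hat A\hat P_L+L_L\big),\\ \nabla_{\hat B}\varphi&=2\big(-(\tilde Y_L+2\tilde Z_L)^*B+(\hat Y_L+2\hat Z_L)\hat B\big),\\ \nabla_{\hat C}\varphi&=2\big(-C\tilde P_L+\hat C\hat P_L\big),\qquad \nabla_{\hat M_j}\varphi=2\big(-\tilde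 P_L^\top M_j\tilde P_L+\hat P_L^\top\hat M_j\hat P_L\big).\end{aligned}$$ Here, with $S=A^L$, $\hat S=\hat A^L$, $\tilde N=\frac12\sum_j(M_j\overline{\tilde P_L}\hat M_j+M_j^\top\overline{\tilde P_L}\hat M_j^\top)$ and $\hat N=\frac12\sum_j(\hat M_j\overline{\hat P_L}\hat M_j+\hat M_j^\top\overline{\hat P_L}\hat M_j^\top)$, the matrices $\tilde P,\hat P,\tilde P_L,\hat P_L,\tilde Y_L,\hat Y_L,\tilde Z_L,\hat Z_L,\bar Z_L,\bar Z_{r,L}$ are the solution, which exists and is unique, of $$\begin{aligned}&\tilde P=A\tilde P\hat A^*+B\hat B^*,&&\hat P=\hat A\hat P\hat A^*+\hat B\hat B^*,\\ &\tilde P_L=A\tilde P_L\hat A^*+B\hat B^*-SB\hat B^*\hat S^*,&&\hat P_L=\hat A\hat P_L\hat A^*+\hat B\hat B^*-\hat S\hat B\hat B^*\hat S^*,\\ &\tilde Y_L=A^*\tilde Y_L\hat A+C^*\hat C-S^*C^*\hat C\hat S,&&\hat Y_L=\hat A^*\hat Y_L\hat A+\hat C^*\hat C-\hat S^*\hat C^*\hat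 C\hat S,\\ &\tilde Z_L=A^*\tilde Z_L\hat A+\tilde N-S^*\tilde N\hat S,&&\hat Z_L=\hat A^*\hat Z_L\hat A+\hat N-\hat S^*\hat N\hat S,\\ &\bar Z_L=A^*\bar Z_L\hat A+\tilde N,&&\bar Z_{r,L}=\hat A^*\bar Z_{r,L}\hat A+\hat N,\end{aligned}$$ and $$\begin{aligned}V_L&=\hat BB^*S^*\bar Z_L-\hat B\hat B^*\hat S^*\bar Z_{r,L}+\tilde P^*S^*C^*\hat C-\hat P\hat S^*\hat C^*\hat C+\tilde P^*S^*\tilde N-\hat P\hat S^*\hat N,\\ L_L&=-(\tilde Y_L+\tilde Z_L)^*A(\tilde P-\tilde P_L)+(\hat Y_L+\hat Z_L)\hat A(\hat P-\hat P_L)-(\bar Z_L-\tilde Z_L)^*A\tilde P_L+(\bar Z_{r,L}-\hat Z_L)\hat A\hat P_L+\sum_{j=0}^{L-1}(\hat A^*)^jV_L^*(\hat A^*)^{L-1-j}.\end{aligned}$$ -/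

import Mathlib

open Matrix
open scoped Kronecker

noncomputable section

/-! ### Linear quadratic-output (LQO) systems and the finite-horizon `h²` norm -/

/-- Discrete-time complex LQO system `x_k = A x_{k-1} + B u_k`,
`y_k = C x_k + [vec M_1, …, vec M_p]ᵀ (x_k ⊗ x_k)`. -/
structure LQO (n m p : ℕ) where
  A : Matrix (Fin n) (Fin n) ℂ
  B : Matrix (Fin n) (Fin m) ℂ
  C : Matrix (Fin p) (Fin n) ℂ
  M : Fin p → Matrix (Fin n) (Fin n) ℂ

/-- Discrete-time stability: every eigenvalue lies strictly inside the unit disk. -/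
def IsStable {n : ℕ} (A : Matrix (Fin n) (Fin n) ℂ) : Prop :=
  ∀ μ ∈ spectrum ℂ A, ‖μ‖ < 1

/-- The square of the Frobenius norm. -/
def frobSq {ι κ : Type*} [Fintype ι] [Fintype κ] (X : Matrix ι κ ℂ) : ℝ :=
  ∑ i, ∑ j, ‖X i j‖ ^ 2

namespace LQO

variable {n m p : ℕ}

/-- The `p × n²` matrix whose `k`-th row is `(vec M_k)ᵀ` (`vec` stacks columns). -/
def quadMat (S : LQO n m p) : Matrix (Fin p) (Fin n × Fin n) ℂ :=
  Matrix.of fun k => Matrix.vec (S.M k)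

/-- First Volterra kernel `h₁[t] = C Aᵗ B`. -/
def h1 (S : LQO n m p) (t : ℕ) : Matrix (Fin p) (Fin m) ℂ :=
  S.C * S.A ^ t * S.B

/-- Second Volterra kernel `h₂[t₁,t₂] = M (A^{t₁} B ⊗ A^{t₂} B)`. -/
def h2 (S : LQO n m p) (t₁ t₂ : ℕ) : Matrix (Fin p) (Fin m × Fin m) ℂ :=
  S.quadMat * ((S.A ^ t₁ * S.B) ⊗ₖ (S.A ^ t₂ * S.B))

/-- `‖h₁‖_{ℓ²_L}`. -/
def h1Norm (L : ℕ) (S : LQO n m p) : ℝ :=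
  Real.sqrt (∑ t ∈ Finset.range L, frobSq (S.h1 t))

/-- `‖h₂‖_{ℓ²_L}`. -/
def h2Norm (L : ℕ) (S : LQO n m p) : ℝ :=
  Real.sqrt (∑ t₁ ∈ Finset.range L, ∑ t₂ ∈ Finset.range L, frobSq (S.h2 t₁ t₂))

/-- `‖S - S'‖²_{h²_L} = ‖h₁ - h₁'‖²_{ℓ²_L} + ‖h₂ - h₂'‖²_{ℓ²_L}`. -/
def errSq {r : ℕ} (L : ℕ) (S : LQO n m p) (S' : LQO r m p) : ℝ :=
  (∑ t ∈ Finset.range L, frobSq (S.h1 t - S'.h1 t)) +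
    ∑ t₁ ∈ Finset.range L, ∑ t₂ ∈ Finset.range L, frobSq (S.h2 t₁ t₂ - S'.h2 t₁ t₂)

/-- `‖S - S'‖_{h²_L}`. -/
def err {r : ℕ} (L : ℕ) (S : LQO n m p) (S' : LQO r m p) : ℝ :=
  Real.sqrt (S.errSq L S')

end LQO

/-! ### The pretrained deep state-space model and the layer weights -/

/-- Layer normalization with scale `γ₁`, bias `γ₂` and parameter `ε`. -/
def layerNorm {m : ℕ} (ε : ℝ) (γ₁ γ₂ : EuclideanSpace ℝ (Fin m))
    (z : EuclideanSpace ℝ (Fin m)) : EuclideanSpace ℝ (Fin m) :=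
  let μ : ℝ := (1 / (m : ℝ)) * ∑ a, z a
  let σ : ℝ := Real.sqrt ((1 / (m : ℝ)) * ∑ a, (z a - μ) ^ 2 + ε)
  WithLp.toLp 2 fun a => γ₁ a * ((z a - μ) / σ) + γ₂ a

/-- The (best) Lipschitz constant of a map, for the Euclidean norm. -/
def lipConst {m : ℕ} (F : EuclideanSpace ℝ (Fin m) → EuclideanSpace ℝ (Fin m)) : ℝ :=
  sInf {K : ℝ | 0 ≤ K ∧ ∀ x y, ‖F x - F y‖ ≤ K * ‖x - y‖}

/-- A `ξ`-layer deep state-space model of state dimension `n` and feature dimension `m`: in layer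
`i` an LQO system with `A = diag Λ` and `M_j = U_jᴴ U_j`, followed by layer normalization. -/
structure DeepSSM (ξ n m c : ℕ) where
  Λ : Fin ξ → Fin n → ℂ
  B : Fin ξ → Matrix (Fin n) (Fin m) ℂ
  C : Fin ξ → Matrix (Fin m) (Fin n) ℂ
  U : Fin ξ → Fin m → Matrix (Fin c) (Fin n) ℂ
  γ₁ : Fin ξ → EuclideanSpace ℝ (Fin m)
  γ₂ : Fin ξ → EuclideanSpace ℝ (Fin m)
  ε : ℝ

namespace DeepSSM

variable {ξ n m c : ℕ}

/-- The LQO system of layer `i`. -/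
def layer (D : DeepSSM ξ n m c) (i : Fin ξ) : LQO n m m where
  A := Matrix.diagonal (D.Λ i)
  B := D.B i
  C := D.C i
  M := fun j => (D.U i j)ᴴ * D.U i j

/-- `ω`, the largest Lipschitz constant of the layer normalizations. -/
def omega (D : DeepSSM ξ n m c) : ℝ :=
  ⨆ i : Fin ξ, lipConst (layerNorm D.ε (D.γ₁ i) (D.γ₂ i))

/-- `g̃_j = 1 + √L (‖h₁^{(j)}‖_{ℓ²_L} + 2 b ‖h₂^{(j)}‖_{ℓ²_L})`. -/
def gTilde (D : DeepSSM ξ n m c) (L : ℕ) (b : ℝ) (j : Fin ξ) : ℝ :=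
  1 + Real.sqrt L * ((D.layer j).h1Norm L + 2 * b * (D.layer j).h2Norm L)

/-- `G̃_i = ω^{ξ-i+1} ∏_{j>i} g̃_j` for `i = 1, …, ξ`; in `Fin ξ` the index is shifted by one,
so that the exponent reads `ξ - i`. -/
def weight (D : DeepSSM ξ n m c) (L : ℕ) (b : ℝ) (i : Fin ξ) : ℝ :=
  D.omega ^ (ξ - (i : ℕ)) * ∏ j ∈ Finset.Ioi i, D.gTilde L b j

end DeepSSM

/-! ### Parameters of reduced systems and the objective -/

/-- Parameters `(Â, B̂, Ĉ, (M̂_j)_j)` of a reduced system with a general `Â`. -/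
abbrev FullParam (r m : ℕ) : Type :=
  Matrix (Fin r) (Fin r) ℂ × Matrix (Fin r) (Fin m) ℂ × Matrix (Fin m) (Fin r) ℂ ×
    (Fin m → Matrix (Fin r) (Fin r) ℂ)

/-- Parameters `(Λ̂, B̂, Ĉ, (M̂_j)_j)` of a reduced system with `Â = diag Λ̂`. -/
abbrev DiagParam (r m : ℕ) : Type :=
  (Fin r → ℂ) × Matrix (Fin r) (Fin m) ℂ × Matrix (Fin m) (Fin r) ℂ ×
    (Fin m → Matrix (Fin r) (Fin r) ℂ)

/-- The reduced system with given parameters. -/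
def romLQO {r m : ℕ} (η : FullParam r m) : LQO r m m where
  A := η.1
  B := η.2.1
  C := η.2.2.1
  M := η.2.2.2

/-- Replace `Λ̂` by `Â = diag Λ̂`. -/
def toFull {r m : ℕ} (η : DiagParam r m) : FullParam r m :=
  (Matrix.diagonal η.1, η.2)

/-- The objective `f = ∑ i, G̃_i ‖S^{(i)} - Ŝ^{(i)}‖_{h²_L}` as a function of the parameters
`(Λ̂^{(i)}, B̂^{(i)}, Ĉ^{(i)}, (M̂_j^{(i)})_j)` of all the layers. -/
def objective {ξ n m c : ℕ} (D : DeepSSM ξ n m c) (L : ℕ) (b : ℝ) {r : Fin ξ → ℕ}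
    (θ : ∀ i, DiagParam (r i) m) : ℝ :=
  ∑ i, D.weight L b i * (D.layer i).err L (romLQO (toFull (θ i)))

/-! ### Gradients -/

/-- `⟨X, Y⟩ = Re tr (Xᴴ Y)`. -/
def matInner {ι κ : Type*} [Fintype ι] [Fintype κ] (X Y : Matrix ι κ ℂ) : ℝ :=
  (Matrix.trace (Xᴴ * Y)).re

/-- `⟨x, y⟩ = Re (x* y)` for vectors. -/
def vecInner {ι : Type*} [Fintype ι] (x y : ι → ℂ) : ℝ :=
  (star x ⬝ᵥ y).re

/-- Sum of the pairings of the blocks `Â`, `B̂`, `Ĉ`, `M̂_j`. -/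
def fullInner {r m : ℕ} (g d : FullParam r m) : ℝ :=
  matInner g.1 d.1 + matInner g.2.1 d.2.1 + matInner g.2.2.1 d.2.2.1 +
    ∑ j, matInner (g.2.2.2 j) (d.2.2.2 j)

/-- Sum of the pairings of the blocks `Λ̂`, `B̂`, `Ĉ`, `M̂_j`. -/
def diagInner {r m : ℕ} (g d : DiagParam r m) : ℝ :=
  vecInner g.1 d.1 + matInner g.2.1 d.2.1 + matInner g.2.2.1 d.2.2.1 +
    ∑ j, matInner (g.2.2.2 j) (d.2.2.2 j)

/-- `g` is the gradient of the real-valued `F` at `x` for the pairing `ip`: `F` is (real) Fréchet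
differentiable at `x` and `dF = ⟨g, dx⟩`. With `ip` the sum of the pairings of several blocks of
variables, the components of `g` are the gradients with respect to these blocks. -/
def HasGradientWrt {E : Type*} [AddCommGroup E] [Module ℝ E] [TopologicalSpace E]
    (ip : E → E → ℝ) (F : E → ℝ) (g x : E) : Prop :=
  ∃ dF : E →L[ℝ] ℝ, (∀ d, dF d = ip g d) ∧ HasFDerivAt F dF x

/-! ### Sylvester and Lyapunov equations, closed-form gradient -/

/-- Candidates for the solutions of the Sylvester and Lyapunov equations: a name ending in `t` is
a tilde (mixed) matrix, in `h` a hat (reduced) matrix, a final `L` marks the horizon;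
`Zbar`, `ZbarR` are `Z̄_L`, `Z̄_{r,L}`. -/
@[ext]
structure Gramians (n r : ℕ) where
  Pt : Matrix (Fin n) (Fin r) ℂ
  Ph : Matrix (Fin r) (Fin r) ℂ
  PtL : Matrix (Fin n) (Fin r) ℂ
  PhL : Matrix (Fin r) (Fin r) ℂ
  YtL : Matrix (Fin n) (Fin r) ℂ
  YhL : Matrix (Fin r) (Fin r) ℂ
  ZtL : Matrix (Fin n) (Fin r) ℂ
  ZhL : Matrix (Fin r) (Fin r) ℂ
  Zbar : Matrix (Fin n) (Fin r) ℂ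
  ZbarR : Matrix (Fin r) (Fin r) ℂ

/-- `N(P) = ½ ∑_k (M_k P̄ M'_k + M_kᵀ P̄ M'_kᵀ)`, with `P̄` the entrywise conjugate of `P`. -/
def quadSource {n r p : ℕ} (M : Fin p → Matrix (Fin n) (Fin n) ℂ)
    (M' : Fin p → Matrix (Fin r) (Fin r) ℂ) (P : Matrix (Fin n) (Fin r) ℂ) :
    Matrix (Fin n) (Fin r) ℂ :=
  (1 / 2 : ℂ) • ∑ k, (M k * P.map star * M' k + (M k)ᵀ * P.map star * (M' k)ᵀ)

/-- The system of finite- and infinite-horizon Sylvester and Lyapunov equations attached to the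
full system `S`, the reduced system `R` and the horizon `L`. -/
structure Gramians.Solves {n r m p : ℕ} (W : Gramians n r) (L : ℕ)
    (S : LQO n m p) (R : LQO r m p) : Prop where
  Pt_eq : W.Pt = S.A * W.Pt * R.Aᴴ + S.B * R.Bᴴ
  Ph_eq : W.Ph = R.A * W.Ph * R.Aᴴ + R.B * R.Bᴴ
  PtL_eq : W.PtL = S.A * W.PtL * R.Aᴴ + S.B * R.Bᴴ - S.A ^ L * S.B * R.Bᴴ * R.Aᴴ ^ L
  PhL_eq : W.PhL = R.A * W.PhL * R.Aᴴ + R.B * R.Bᴴ - R.A ^ L * R.B * R.Bᴴ * R.Aᴴ ^ L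
  YtL_eq : W.YtL = S.Aᴴ * W.YtL * R.A + S.Cᴴ * R.C - (S.A ^ L)ᴴ * S.Cᴴ * R.C * R.A ^ L
  YhL_eq : W.YhL = R.Aᴴ * W.YhL * R.A + R.Cᴴ * R.C - (R.A ^ L)ᴴ * R.Cᴴ * R.C * R.A ^ L
  ZtL_eq : W.ZtL = S.Aᴴ * W.ZtL * R.A + quadSource S.M R.M W.PtL -
    (S.A ^ L)ᴴ * quadSource S.M R.M W.PtL * R.A ^ L
  ZhL_eq : W.ZhL = R.Aᴴ * W.ZhL * R.A + quadSource R.M R.M W.PhL -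
    (R.A ^ L)ᴴ * quadSource R.M R.M W.PhL * R.A ^ L
  Zbar_eq : W.Zbar = S.Aᴴ * W.Zbar * R.A + quadSource S.M R.M W.PtL
  ZbarR_eq : W.ZbarR = R.Aᴴ * W.ZbarR * R.A + quadSource R.M R.M W.PhL

/-- `T*_{Â,L}(X) = ∑_{j<L} (Âᴴ)ʲ X (Âᴴ)^{L-1-j}`. -/
def adjSum {r : ℕ} (A : Matrix (Fin r) (Fin r) ℂ) (L : ℕ) (X : Matrix (Fin r) (Fin r) ℂ) :
    Matrix (Fin r) (Fin r) ℂ :=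
  ∑ j ∈ Finset.range L, Aᴴ ^ j * X * Aᴴ ^ (L - 1 - j)

namespace Gramians

variable {n r m p : ℕ}

/-- The matrix `V_L`. -/
def VL (W : Gramians n r) (L : ℕ) (S : LQO n m p) (R : LQO r m p) : Matrix (Fin r) (Fin r) ℂ :=
  R.B * S.Bᴴ * (S.A ^ L)ᴴ * W.Zbar - R.B * R.Bᴴ * (R.A ^ L)ᴴ * W.ZbarR
    + W.Ptᴴ * (S.A ^ L)ᴴ * S.Cᴴ * R.C - W.Ph * (R.A ^ L)ᴴ * R.Cᴴ * R.C
    + (W.Ptᴴ * (S.A ^ L)ᴴ * quadSource S.M R.M W.PtL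
      - W.Ph * (R.A ^ L)ᴴ * quadSource R.M R.M W.PhL)

/-- The matrix `L_L`. -/
def LL (W : Gramians n r) (L : ℕ) (S : LQO n m p) (R : LQO r m p) : Matrix (Fin r) (Fin r) ℂ :=
  -((W.YtL + W.ZtL)ᴴ * S.A * (W.Pt - W.PtL)) + (W.YhL + W.ZhL) * R.A * (W.Ph - W.PhL)
    - (W.Zbar - W.ZtL)ᴴ * S.A * W.PtL + (W.ZbarR - W.ZhL) * R.A * W.PhL
    + adjSum R.A L (W.VL L S R)ᴴ

/-- Closed form of `∇_Â φ`. -/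
def gradA (W : Gramians n r) (L : ℕ) (S : LQO n m p) (R : LQO r m p) :
    Matrix (Fin r) (Fin r) ℂ :=
  (2 : ℂ) • (-((W.YtL + (2 : ℂ) • W.ZtL)ᴴ * S.A * W.PtL)
    + (W.YhL + (2 : ℂ) • W.ZhL) * R.A * W.PhL + W.LL L S R)

/-- Closed form of `∇_B̂ φ`. -/
def gradB (W : Gramians n r) (S : LQO n m p) (R : LQO r m p) : Matrix (Fin r) (Fin m) ℂ :=
  (2 : ℂ) • (-((W.YtL + (2 : ℂ) • W.ZtL)ᴴ * S.B) + (W.YhL + (2 : ℂ) • W.ZhL) * R.B)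

/-- Closed form of `∇_Ĉ φ`. -/
def gradC (W : Gramians n r) (S : LQO n m p) (R : LQO r m p) : Matrix (Fin p) (Fin r) ℂ :=
  (2 : ℂ) • (-(S.C * W.PtL) + R.C * W.PhL)

/-- Closed form of `∇_{M̂_j} φ`. -/
def gradM (W : Gramians n r) (S : LQO n m p) (R : LQO r m p) (j : Fin p) :
    Matrix (Fin r) (Fin r) ℂ :=
  (2 : ℂ) • (-(W.PtLᵀ * S.M j * W.PtL) + W.PhLᵀ * R.M j * W.PhL)

end Gramians

/-- The gradient of `f` with respect to the parameters of one layer, built from the gradient `g` of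
the squared error of that layer and the scalar `κ`: `Λ̂` receives the diagonal of the `Â`-part. -/
def scaledDiagGrad {r m : ℕ} (κ : ℝ) (g : FullParam r m) : DiagParam r m :=
  (κ • Matrix.diag g.1, κ • g.2.1, κ • g.2.2.1, fun j => κ • g.2.2.2 j)

end

noncomputable section

/-! ### Sylvester equations -/

/-! Up to the horizon the kernels are polynomials in the reduced parameters, so φ is differentiable
and dφ = 2 Re⟨ĥ - h, dĥ⟩ (`hasGradientWrt_errSq`). Both halves are the same expression
`kernelPairing`, evaluated once at the reduced system and once at the full one, so a single adjoint
computation for an arbitrary system T serves both.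

In that computation dĥ involves dĈ, dM̂ and d(Âᵗ B̂). Summing over the time index that does not
carry the differential produces the finite Gramian P_L; what remains is ∑ₜ ⟨Qᴴ Aᵗ B, d(Âᵗ B̂)⟩ with
Q = Cᴴ Ĉ + 2N (`kernelPairing_eq`). The B̂-part is a Sylvester sum, the Â-part the double sum
`pairSum`.

The double sum telescopes in two ways: replace its right factor B B̂ᴴ by P - A P Âᴴ, or replace its
left factor Nᴴ by Z̄ᴴ - Âᴴ Z̄ᴴ A. The closed form uses the first for Cᴴ Ĉ and for one copy of N, the
second for the other copy of N (`pairSum_outSource`). This is why V_L and L_L contain both P̃ and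
Z̄_L; V_L collects the boundary terms at t = L.

For diagonal stable matrices every Sylvester equation decouples into scalar ones, which gives
existence and uniqueness and identifies the finite-horizon solutions with finite sums. Uniqueness
also makes the reduced solutions Hermitian, so the adjoints on the hat terms disappear. The passage
to f is the chain rule for the square root and for Λ̂ ↦ diag Λ̂, the weights being constants of the
pretrained model. -/

theorem IsStable.norm_lt_one_of_diagonal {n : ℕ} {a : Fin n → ℂ}
    (h : IsStable (diagonal a)) (i : Fin n) : ‖a i‖ < 1 := by
  refine h _ ?_
  rw [spectrum_diagonal]
  exact ⟨i, rfl⟩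

/-- Entry (i, j) of the equation reads (1 - a i * b j) X i j = Q i j, and the scalar factor is
nonzero because |a i * b j| < 1. -/
theorem existsUnique_sylvester_diagonal {ι κ : Type*} [Fintype ι] [Fintype κ] [DecidableEq ι]
    [DecidableEq κ] {a : ι → ℂ} {b : κ → ℂ} (ha : ∀ i, ‖a i‖ < 1) (hb : ∀ j, ‖b j‖ < 1)
    (Q : Matrix ι κ ℂ) : ∃! X : Matrix ι κ ℂ, X = diagonal a * X * diagonal b + Q := by
  have key : ∀ i j, 1 - a i * b j ≠ 0 := by
    intro i j h
    have h1 : ‖a i * b j‖ < 1 := by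
      rw [norm_mul]
      exact mul_lt_one_of_nonneg_of_lt_one_left (norm_nonneg _) (ha i) (hb j).le
    rw [← sub_eq_zero.mp h, norm_one] at h1
    exact lt_irrefl _ h1
  refine ⟨of fun i j => Q i j / (1 - a i * b j), ?_, ?_⟩
  · ext i j
    have := key i j
    simp only [Matrix.add_apply, mul_diagonal, diagonal_mul, of_apply]
    field_simp
    ring
  · intro X hX
    ext i j
    have := congrArg (fun Y : Matrix ι κ ℂ => Y i j) hX
    simp only [Matrix.add_apply, mul_diagonal, diagonal_mul] at this
    rw [of_apply, eq_div_iff (key i j)]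
    linear_combination this

/-! ### Finite Sylvester sums and the two telescopings of the double sum -/

section Sums

variable {ι κ : Type*} [Fintype ι] [Fintype κ] [DecidableEq ι] [DecidableEq κ]

/-- `∑_{t<L} Fᵗ Q Gᵗ`. -/
def sylvSum (F : Matrix ι ι ℂ) (Q : Matrix ι κ ℂ) (G : Matrix κ κ ℂ) (L : ℕ) : Matrix ι κ ℂ :=
  ∑ t ∈ Finset.range L, F ^ t * Q * G ^ t

theorem sylvSum_succ (F : Matrix ι ι ℂ) (Q : Matrix ι κ ℂ) (G : Matrix κ κ ℂ) (L : ℕ) :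
    sylvSum F Q G (L + 1) = sylvSum F Q G L + F ^ L * Q * G ^ L :=
  Finset.sum_range_succ _ _

/-- Telescoping, with no stability assumption: the finite sum always solves the finite-horizon
equation. Stability enters only for uniqueness. -/
theorem sylvSum_eq (F : Matrix ι ι ℂ) (Q : Matrix ι κ ℂ) (G : Matrix κ κ ℂ) (L : ℕ) :
    sylvSum F Q G L = F * sylvSum F Q G L * G + (Q - F ^ L * Q * G ^ L) := by
  induction L with
  | zero => simp [sylvSum]
  | succ L ih =>
    rw [sylvSum_succ, Matrix.mul_add, Matrix.add_mul]
    nth_rewrite 1 [ih]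
    rw [pow_succ' F, pow_succ G]
    simp only [Matrix.mul_assoc]
    abel

theorem conjTranspose_sylvSum (F : Matrix ι ι ℂ) (Q : Matrix ι κ ℂ) (G : Matrix κ κ ℂ) (L : ℕ) :
    (sylvSum F Q G L)ᴴ = sylvSum Gᴴ Qᴴ Fᴴ L := by
  simp [sylvSum, conjTranspose_sum, conjTranspose_mul, conjTranspose_pow, Matrix.mul_assoc]

/-- `∑_{s+u+1=t<L} Gˢ Q Fᵗ P Gᵘ`. -/
def pairSum (G : Matrix κ κ ℂ) (Q : Matrix κ ι ℂ) (F : Matrix ι ι ℂ) (P : Matrix ι κ ℂ) (L : ℕ) :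
    Matrix κ κ ℂ :=
  ∑ t ∈ Finset.range L, ∑ s ∈ Finset.range t, G ^ s * (Q * F ^ t * P) * G ^ (t - 1 - s)

/-- `∑_{j<L} Gʲ X G^{L-1-j}`. -/
def powSum (G X : Matrix κ κ ℂ) (L : ℕ) : Matrix κ κ ℂ :=
  ∑ j ∈ Finset.range L, G ^ j * X * G ^ (L - 1 - j)

theorem pairSum_succ (G : Matrix κ κ ℂ) (Q : Matrix κ ι ℂ) (F : Matrix ι ι ℂ) (P : Matrix ι κ ℂ)
    (L : ℕ) : pairSum G Q F P (L + 1) = pairSum G Q F P L + powSum G (Q * F ^ L * P) L :=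
  Finset.sum_range_succ _ _

theorem pairSum_add (G : Matrix κ κ ℂ) (Q Q' : Matrix κ ι ℂ) (F : Matrix ι ι ℂ) (P : Matrix ι κ ℂ)
    (L : ℕ) : pairSum G (Q + Q') F P L = pairSum G Q F P L + pairSum G Q' F P L := by
  simp [pairSum, Matrix.add_mul, Matrix.mul_add, Finset.sum_add_distrib]

theorem powSum_add (G X Y : Matrix κ κ ℂ) (L : ℕ) :
    powSum G (X + Y) L = powSum G X L + powSum G Y L := by
  simp [powSum, Matrix.add_mul, Matrix.mul_add, Finset.sum_add_distrib]

theorem powSum_sub (G X Y : Matrix κ κ ℂ) (L : ℕ) :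
    powSum G (X - Y) L = powSum G X L - powSum G Y L := by
  simp [powSum, Matrix.sub_mul, Matrix.mul_sub, Finset.sum_sub_distrib]

/-- The last term is split off here and the first term in `powSum_succ'`; the spare factor G is
absorbed into X on the right or on the left, matching the two telescopings below. -/
theorem powSum_succ (G X : Matrix κ κ ℂ) (L : ℕ) :
    powSum G X (L + 1) = powSum G (X * G) L + G ^ L * X := by
  rw [powSum, Finset.sum_range_succ]
  congr 1
  · refine Finset.sum_congr rfl fun j hj => ?_
    have : L + 1 - 1 - j = (L - 1 - j) + 1 := by have := Finset.mem_range.mp hj; omega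
    rw [this, pow_succ']
    simp only [Matrix.mul_assoc]
  · simp

theorem powSum_succ' (G X : Matrix κ κ ℂ) (L : ℕ) :
    powSum G X (L + 1) = powSum G (G * X) L + X * G ^ L := by
  rw [powSum, Finset.sum_range_succ']
  congr 1
  · refine Finset.sum_congr rfl fun j hj => ?_
    have : L + 1 - 1 - (j + 1) = L - 1 - j := by omega
    rw [this, pow_succ]
    simp only [Matrix.mul_assoc]
  · simp

/-- With P₀ = P - F P G the t-th inner sum becomes a difference of consecutive `powSum`s of Q Fᵗ P,
up to the term Gᵗ Q Fᵗ⁺¹ P. The differences leave the boundary term at L; the leftover terms add up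
to a Sylvester sum. -/
theorem pairSum_eq_of_right {G : Matrix κ κ ℂ} (Q : Matrix κ ι ℂ) {F : Matrix ι ι ℂ}
    {P P₀ : Matrix ι κ ℂ} (hP : P = F * P * G + P₀) (L : ℕ) :
    pairSum G Q F P₀ L = sylvSum G Q F L * F * P - powSum G (Q * F ^ L * P) L := by
  induction L with
  | zero => simp [pairSum, sylvSum, powSum]
  | succ L ih =>
    have h0 : Q * F ^ L * P₀ = Q * F ^ L * P - Q * F ^ (L + 1) * P * G := by
      rw [eq_sub_of_add_eq' hP.symm, pow_succ]
      simp only [Matrix.mul_sub, Matrix.mul_assoc]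
    rw [pairSum_succ, ih, h0, powSum_sub, powSum_succ, sylvSum_succ, Matrix.add_mul,
      Matrix.add_mul, pow_succ F]
    simp only [Matrix.mul_assoc]
    abel

/-- Mirror image of `pairSum_eq_of_right`: here the left factor is eliminated through Q = Z - G Z F.
-/
theorem pairSum_eq_of_left {G : Matrix κ κ ℂ} {Q Z : Matrix κ ι ℂ} {F : Matrix ι ι ℂ}
    (hZ : Z = G * Z * F + Q) (P₀ : Matrix ι κ ℂ) (L : ℕ) :
    pairSum G Q F P₀ L = Z * F * sylvSum F P₀ G L - powSum G (Z * F ^ L * P₀) L := by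
  induction L with
  | zero => simp [pairSum, sylvSum, powSum]
  | succ L ih =>
    have h0 : Q * F ^ L * P₀ = Z * F ^ L * P₀ - G * (Z * F ^ (L + 1) * P₀) := by
      rw [eq_sub_of_add_eq' hZ.symm, pow_succ']
      simp only [Matrix.sub_mul, Matrix.mul_assoc]
    rw [pairSum_succ, ih, h0, powSum_sub, powSum_succ', sylvSum_succ, Matrix.mul_add, pow_succ' F]
    simp only [Matrix.mul_assoc]
    abel

end Sums

/-! ### Differentiation of matrix-valued maps -/

section Deriv

variable {E : Type*} [NormedAddCommGroup E] [NormedSpace ℝ E]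
  {ι κ τ : Type*}

/-- `f` is Fréchet differentiable at `x`, entry by entry, and `d ↦ f' d` is its derivative. -/
def HasMatDeriv (f f' : E → Matrix ι κ ℂ) (x : E) : Prop :=
  ∀ i j, ∃ F : E →L[ℝ] ℂ, (∀ d, F d = f' d i j) ∧ HasFDerivAt (fun y => f y i j) F x

theorem HasMatDeriv.const (X : Matrix ι κ ℂ) (x : E) :
    HasMatDeriv (fun _ => X) (fun _ => 0) x :=
  fun i j => ⟨0, fun _ => rfl, hasFDerivAt_const (X i j) x⟩

theorem HasMatDeriv.sub {f f' g g' : E → Matrix ι κ ℂ} {x : E} (hf : HasMatDeriv f f' x)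
    (hg : HasMatDeriv g g' x) :
    HasMatDeriv (fun y => f y - g y) (fun d => f' d - g' d) x := by
  intro i j
  obtain ⟨F, hF, hF'⟩ := hf i j
  obtain ⟨G, hG, hG'⟩ := hg i j
  exact ⟨F - G, fun d => by simp [hF, hG], hF'.sub hG'⟩

theorem HasMatDeriv.transpose {f f' : E → Matrix ι κ ℂ} {x : E} (hf : HasMatDeriv f f' x) :
    HasMatDeriv (fun y => (f y)ᵀ) (fun d => (f' d)ᵀ) x :=
  fun i j => hf j i

theorem HasMatDeriv.mul [Fintype κ] {f f' : E → Matrix ι κ ℂ} {g g' : E → Matrix κ τ ℂ} {x : E}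
    (hf : HasMatDeriv f f' x) (hg : HasMatDeriv g g' x) :
    HasMatDeriv (fun y => f y * g y) (fun d => f' d * g x + f x * g' d) x := by
  intro i j
  choose F hF hF' using fun k => hf i k
  choose G hG hG' using fun k => hg k j
  refine ⟨∑ k, (f x i k • G k + g x k j • F k), fun d => ?_, ?_⟩
  · simp only [_root_.sum_apply, _root_.add_apply,
      _root_.smul_apply, smul_eq_mul, hF, hG, Matrix.add_apply, Matrix.mul_apply,
      ← Finset.sum_add_distrib]
    exact Finset.sum_congr rfl fun k _ => by ring
  · simp only [Matrix.mul_apply]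
    exact HasFDerivAt.fun_sum fun k _ => (hF' k).mul (hG' k)

/-- Noncommutative Leibniz rule: dA is inserted at each of the t positions of the product. -/
theorem HasMatDeriv.pow [Fintype κ] [DecidableEq κ] {f f' : E → Matrix κ κ ℂ} {x : E}
    (hf : HasMatDeriv f f' x) (t : ℕ) :
    HasMatDeriv (fun y => f y ^ t) (fun d => powSum (f x) (f' d) t) x := by
  induction t with
  | zero => simpa [powSum] using HasMatDeriv.const (1 : Matrix κ κ ℂ) x
  | succ t ih =>
    have h := ih.mul hf
    simp only [← pow_succ] at h
    convert h using 2 with d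
    rw [powSum, Finset.sum_range_succ, powSum, Finset.sum_mul]
    congr 1
    · refine Finset.sum_congr rfl fun s hs => ?_
      have : t + 1 - 1 - s = (t - 1 - s) + 1 := by have := Finset.mem_range.mp hs; omega
      rw [this, pow_succ]
      simp only [Matrix.mul_assoc]
    · simp

theorem matInner_eq_sum [Fintype ι] [Fintype κ] (X Y : Matrix ι κ ℂ) :
    matInner X Y = ∑ i, ∑ j, (star (X i j) * Y i j).re := by
  simp only [matInner, Matrix.trace, Matrix.diag_apply, Matrix.mul_apply, conjTranspose_apply,
    Complex.re_sum]
  exact Finset.sum_comm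

/-- Here and in the combinators below, the pairing ignores its first argument: the linear form
itself records the differential, and the point x merely fills the gradient slot.
`HasGradientWrt.congr_right` later substitutes the genuine pairing and gradient. -/
theorem HasMatDeriv.frobSq [Fintype ι] [Fintype κ] {f f' : E → Matrix ι κ ℂ} {x : E} (hf : HasMatDeriv f f' x) :
    HasGradientWrt (fun _ d => 2 * matInner (f x) (f' d)) (fun y => frobSq (f y)) x x := by
  choose F hF hF' using hf
  refine ⟨∑ i, ∑ j, 2 • (innerSL ℝ (f x i j)).comp (F i j), fun d => ?_, ?_⟩
  · simp only [_root_.sum_apply, _root_.smul_apply,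
      ContinuousLinearMap.comp_apply, innerSL_apply_apply, hF, matInner_eq_sum, Finset.mul_sum,
      Complex.inner, nsmul_eq_mul, Nat.cast_ofNat, mul_comm (star _)]
    rfl
  · exact HasFDerivAt.fun_sum fun i _ => HasFDerivAt.fun_sum fun j _ => (hF' i j).norm_sq

end Deriv

/-! ### Sums, scalar multiples and square roots of differentiable functions -/

section Grad

variable {E : Type*} [NormedAddCommGroup E] [NormedSpace ℝ E]

theorem HasGradientWrt.sum {α : Type*} {s : Finset α} {ip : α → E → E → ℝ} {F : α → E → ℝ}
    {g : α → E} {x : E} (h : ∀ a ∈ s, HasGradientWrt (ip a) (F a) (g a) x) :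
    HasGradientWrt (fun _ d => ∑ a ∈ s, ip a (g a) d) (fun y => ∑ a ∈ s, F a y) x x := by
  choose! G hG hG' using h
  refine ⟨∑ a ∈ s, G a, fun d => ?_, HasFDerivAt.fun_sum hG'⟩
  rw [_root_.sum_apply]
  exact Finset.sum_congr rfl fun a ha => hG a ha d

theorem HasGradientWrt.add {ip ip' : E → E → ℝ} {F F' : E → ℝ} {g g' x : E}
    (h : HasGradientWrt ip F g x) (h' : HasGradientWrt ip' F' g' x) :
    HasGradientWrt (fun _ d => ip g d + ip' g' d) (fun y => F y + F' y) x x := by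
  obtain ⟨G, hG, hG'⟩ := h
  obtain ⟨H, hH, hH'⟩ := h'
  exact ⟨G + H, fun d => by simp [hG, hH], hG'.add hH'⟩

theorem HasGradientWrt.add_const {ip : E → E → ℝ} {F : E → ℝ} {g x : E}
    (h : HasGradientWrt ip F g x) (c : ℝ) : HasGradientWrt ip (fun y => F y + c) g x := by
  obtain ⟨G, hG, hG'⟩ := h
  exact ⟨G, hG, hG'.add_const c⟩

theorem HasGradientWrt.mul_sqrt {ip : E → E → ℝ} {F : E → ℝ} {g x : E}
    (h : HasGradientWrt ip F g x) (hx : F x ≠ 0) (c : ℝ) :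
    HasGradientWrt (fun _ d => c / (2 * √(F x)) * ip g d) (fun y => c * √(F y)) x x := by
  obtain ⟨G, hG, hG'⟩ := h
  refine ⟨c • ((1 / (2 * √(F x))) • G), fun d => ?_, (hG'.sqrt hx).const_mul c⟩
  simp only [_root_.smul_apply, smul_eq_mul, hG]
  ring

theorem HasGradientWrt.congr_right {ip ip' : E → E → ℝ} {F : E → ℝ} {g g' x : E}
    (h : HasGradientWrt ip F g x) (hip : ∀ d, ip g d = ip' g' d) : HasGradientWrt ip' F g' x := by
  obtain ⟨G, hG, hG'⟩ := h
  exact ⟨G, fun d => (hG d).trans (hip d), hG'⟩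

theorem HasGradientWrt.comp_clm {E' : Type*} [NormedAddCommGroup E'] [NormedSpace ℝ E']
    {ip : E → E → ℝ} {F : E → ℝ} {g : E} {x : E'} (l : E' →L[ℝ] E)
    (h : HasGradientWrt ip F g (l x)) :
    HasGradientWrt (fun _ d => ip g (l d)) (fun y => F (l y)) x x := by
  obtain ⟨G, hG, hG'⟩ := h
  exact ⟨G.comp l, fun d => hG (l d), hG'.comp x l.hasFDerivAt⟩

end Grad

/-! ### The pairing of matrices -/

section Inner

variable {ι κ τ : Type*} [Fintype ι] [Fintype κ] [Fintype τ]

theorem matInner_add_left (X X' Y : Matrix ι κ ℂ) :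
    matInner (X + X') Y = matInner X Y + matInner X' Y := by
  simp [matInner, Matrix.add_mul]

theorem matInner_sub_left (X X' Y : Matrix ι κ ℂ) :
    matInner (X - X') Y = matInner X Y - matInner X' Y := by
  simp [matInner, Matrix.sub_mul]

theorem matInner_add_right (X Y Y' : Matrix ι κ ℂ) :
    matInner X (Y + Y') = matInner X Y + matInner X Y' := by
  simp [matInner, Matrix.mul_add]

theorem matInner_zero_sub (X Y : Matrix ι κ ℂ) : matInner X (0 - Y) = -matInner X Y := by
  simp [matInner]

theorem matInner_sum_left {α : Type*} (s : Finset α) (X : α → Matrix ι κ ℂ) (Y : Matrix ι κ ℂ) :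
    matInner (∑ a ∈ s, X a) Y = ∑ a ∈ s, matInner (X a) Y := by
  simp [matInner, conjTranspose_sum, Matrix.sum_mul, trace_sum, Complex.re_sum]

theorem matInner_sum_right {α : Type*} (s : Finset α) (X : Matrix ι κ ℂ) (Y : α → Matrix ι κ ℂ) :
    matInner X (∑ a ∈ s, Y a) = ∑ a ∈ s, matInner X (Y a) := by
  simp [matInner, Matrix.mul_sum, trace_sum, Complex.re_sum]

theorem matInner_two_smul_left (X Y : Matrix ι κ ℂ) :
    matInner ((2 : ℂ) • X) Y = 2 * matInner X Y := by
  simp [matInner]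

theorem matInner_real_smul_left (c : ℝ) (X Y : Matrix ι κ ℂ) :
    matInner (c • X) Y = c * matInner X Y := by
  simp [matInner]

theorem matInner_mul_left (X : Matrix ι κ ℂ) (F : Matrix ι τ ℂ) (Y : Matrix τ κ ℂ) :
    matInner X (F * Y) = matInner (Fᴴ * X) Y := by
  simp [matInner, Matrix.mul_assoc]

theorem matInner_mul_right (X : Matrix ι κ ℂ) (Y : Matrix ι τ ℂ) (G : Matrix τ κ ℂ) :
    matInner X (Y * G) = matInner (X * Gᴴ) Y := by
  simp only [matInner, conjTranspose_mul, conjTranspose_conjTranspose]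
  rw [← Matrix.mul_assoc, Matrix.trace_mul_comm, Matrix.mul_assoc]

theorem matInner_transpose (X : Matrix ι κ ℂ) (Y : Matrix κ ι ℂ) :
    matInner X Yᵀ = matInner Xᵀ Y := by
  rw [matInner, matInner, ← Matrix.trace_transpose, Matrix.transpose_mul, transpose_transpose,
    Matrix.trace_mul_comm]
  rfl

/-- Multiplication by a power of F is adjoint to multiplication by the same power of Fᴴ on the same
side, so the sum keeps its shape term by term. -/
theorem matInner_powSum [DecidableEq κ] (X : Matrix κ ι ℂ) (F D : Matrix κ κ ℂ)
    (B : Matrix κ ι ℂ) (t : ℕ) :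
    matInner X (powSum F D t * B) = matInner (powSum Fᴴ (X * Bᴴ) t) D := by
  rw [matInner_mul_right, powSum, powSum, matInner_sum_right, matInner_sum_left]
  refine Finset.sum_congr rfl fun s _ => ?_
  rw [matInner_mul_right, matInner_mul_left, conjTranspose_pow, conjTranspose_pow]
  simp only [Matrix.mul_assoc]

end Inner

/-! ### The differential of the Volterra kernels, paired with the kernels of a system -/

/-- Row k of h₂, reshaped to an m × m matrix, is a sandwich of M_k. The transpose on M_k comes from
`vec` stacking columns. -/
theorem LQO.h2_apply {n m p : ℕ} (S : LQO n m p) (t₁ t₂ : ℕ) (k : Fin p) (a b : Fin m) :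
    S.h2 t₁ t₂ k (a, b) = ((S.A ^ t₁ * S.B)ᵀ * (S.M k)ᵀ * (S.A ^ t₂ * S.B)) a b := by
  rw [LQO.h2, LQO.quadMat, Matrix.mul_apply, Fintype.sum_prod_type, Finset.sum_comm,
    Matrix.mul_apply]
  refine Finset.sum_congr rfl fun j _ => ?_
  rw [Matrix.mul_apply, Finset.sum_mul]
  refine Finset.sum_congr rfl fun i _ => ?_
  simp only [transpose_apply, of_apply, vec, kroneckerMap_apply]
  ring

theorem LQO.frobSq_h2_sub {n r m p : ℕ} (S : LQO n m p) (R : LQO r m p) (t₁ t₂ : ℕ) :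
    frobSq (S.h2 t₁ t₂ - R.h2 t₁ t₂) =
      ∑ k, frobSq ((S.A ^ t₁ * S.B)ᵀ * (S.M k)ᵀ * (S.A ^ t₂ * S.B)
        - (R.A ^ t₁ * R.B)ᵀ * (R.M k)ᵀ * (R.A ^ t₂ * R.B)) := by
  simp only [frobSq, Fintype.sum_prod_type, Matrix.sub_apply, LQO.h2_apply]

/-- The differential of `Âᵗ B̂`. -/
def dInput {r m : ℕ} (η d : FullParam r m) (t : ℕ) : Matrix (Fin r) (Fin m) ℂ :=
  powSum η.1 d.1 t * η.2.1 + η.1 ^ t * d.2.1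

/-- The differential of `ĥ₁[t]`. -/
def dKernel₁ {r m : ℕ} (η d : FullParam r m) (t : ℕ) : Matrix (Fin m) (Fin m) ℂ :=
  d.2.2.1 * (η.1 ^ t * η.2.1) + η.2.2.1 * dInput η d t

/-- The differential of `(Â^{t₁} B̂)ᵀ M̂_kᵀ (Â^{t₂} B̂)`. -/
def dKernel₂ {r m : ℕ} (η d : FullParam r m) (t₁ t₂ : ℕ) (k : Fin m) :
    Matrix (Fin m) (Fin m) ℂ :=
  ((dInput η d t₁)ᵀ * (η.2.2.2 k)ᵀ + (η.1 ^ t₁ * η.2.1)ᵀ * (d.2.2.2 k)ᵀ) * (η.1 ^ t₂ * η.2.1)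
    + (η.1 ^ t₁ * η.2.1)ᵀ * (η.2.2.2 k)ᵀ * dInput η d t₂

/-- The kernels of `T` up to the horizon, paired with the differential of those of the reduced
system. -/
def kernelPairing {n r m : ℕ} (L : ℕ) (T : LQO n m m) (η d : FullParam r m) : ℝ :=
  (∑ t ∈ Finset.range L, matInner (T.C * (T.A ^ t * T.B)) (dKernel₁ η d t)) +
    ∑ t₁ ∈ Finset.range L, ∑ t₂ ∈ Finset.range L, ∑ k,
      matInner ((T.A ^ t₁ * T.B)ᵀ * (T.M k)ᵀ * (T.A ^ t₂ * T.B)) (dKernel₂ η d t₁ t₂ k)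

/-- Only h - ĥ varies, with differential -dĥ; hence dφ = -2⟨h - ĥ, dĥ⟩, which splits into the
pairings with ĥ and with h. -/
theorem hasGradientWrt_errSq {E : Type*} [NormedAddCommGroup E] [NormedSpace ℝ E]
    {n r m : ℕ} (L : ℕ) (S : LQO n m m) {η η' : E → FullParam r m} {x : E}
    (hA : HasMatDeriv (fun y => (η y).1) (fun d => (η' d).1) x)
    (hB : HasMatDeriv (fun y => (η y).2.1) (fun d => (η' d).2.1) x)
    (hC : HasMatDeriv (fun y => (η y).2.2.1) (fun d => (η' d).2.2.1) x)
    (hM : ∀ k, HasMatDeriv (fun y => (η y).2.2.2 k) (fun d => (η' d).2.2.2 k) x) :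
    HasGradientWrt (fun _ d => 2 * (kernelPairing L (romLQO (η x)) (η x) (η' d)
      - kernelPairing L S (η x) (η' d))) (fun y => S.errSq L (romLQO (η y))) x x := by
  have hX : ∀ t, HasMatDeriv (fun y => (η y).1 ^ t * (η y).2.1)
      (fun d => dInput (η x) (η' d) t) x := fun t => (hA.pow t).mul hB
  have h1 : ∀ t, HasMatDeriv (fun y => S.C * (S.A ^ t * S.B) -
      (η y).2.2.1 * ((η y).1 ^ t * (η y).2.1)) (fun d => 0 - dKernel₁ (η x) (η' d) t) x :=
    fun t => (HasMatDeriv.const _ x).sub (hC.mul (hX t))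
  have h2 : ∀ t₁ t₂ k, HasMatDeriv (fun y => (S.A ^ t₁ * S.B)ᵀ * (S.M k)ᵀ * (S.A ^ t₂ * S.B) -
      ((η y).1 ^ t₁ * (η y).2.1)ᵀ * ((η y).2.2.2 k)ᵀ * ((η y).1 ^ t₂ * (η y).2.1))
      (fun d => 0 - dKernel₂ (η x) (η' d) t₁ t₂ k) x := fun t₁ t₂ k =>
    (HasMatDeriv.const _ x).sub (((hX t₁).transpose.mul (hM k).transpose).mul (hX t₂))
  have h := (HasGradientWrt.sum (s := Finset.range L) fun t _ => (h1 t).frobSq).add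
    (HasGradientWrt.sum (s := Finset.range L) fun t₁ _ =>
      HasGradientWrt.sum (s := Finset.range L) fun t₂ _ =>
        HasGradientWrt.sum (s := Finset.univ) fun k _ => (h2 t₁ t₂ k).frobSq)
  have hF : (fun y => S.errSq L (romLQO (η y))) = fun y =>
      (∑ t ∈ Finset.range L, frobSq (S.C * (S.A ^ t * S.B) -
        (η y).2.2.1 * ((η y).1 ^ t * (η y).2.1))) +
      ∑ t₁ ∈ Finset.range L, ∑ t₂ ∈ Finset.range L, ∑ k,
        frobSq ((S.A ^ t₁ * S.B)ᵀ * (S.M k)ᵀ * (S.A ^ t₂ * S.B) -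
          ((η y).1 ^ t₁ * (η y).2.1)ᵀ * ((η y).2.2.2 k)ᵀ * ((η y).1 ^ t₂ * (η y).2.1)) := by
    funext y
    simp only [LQO.errSq, LQO.frobSq_h2_sub, LQO.h1, Matrix.mul_assoc]
    rfl
  rw [hF]
  refine h.congr_right fun d => ?_
  simp only [kernelPairing, matInner_zero_sub, matInner_sub_left, Finset.sum_sub_distrib,
    mul_sub, Finset.mul_sum, neg_sub, mul_add, romLQO]
  ring

/-! ### The adjoint of the differential -/

section Adjoint

variable {n r m : ℕ}

/-- The finite-horizon mixed Gramian `∑_{t<L} Aᵗ B B̂ᴴ (Âᴴ)ᵗ`. -/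
def finGramian (L : ℕ) (T : LQO n m m) (R : LQO r m m) : Matrix (Fin n) (Fin r) ℂ :=
  sylvSum T.A (T.B * R.Bᴴ) R.Aᴴ L

theorem finGramian_eq_sum (L : ℕ) (T : LQO n m m) (R : LQO r m m) :
    finGramian L T R = ∑ t ∈ Finset.range L, (T.A ^ t * T.B) * (R.A ^ t * R.B)ᴴ := by
  rw [finGramian, sylvSum]
  refine Finset.sum_congr rfl fun t _ => ?_
  simp only [conjTranspose_mul, conjTranspose_pow, Matrix.mul_assoc]

theorem finGramian_transpose_eq_sum (L : ℕ) (T : LQO n m m) (R : LQO r m m) :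
    (finGramian L T R)ᵀ = ∑ t ∈ Finset.range L, (R.A ^ t * R.B)ᴴᵀ * (T.A ^ t * T.B)ᵀ := by
  simp only [finGramian_eq_sum, Matrix.transpose_sum, Matrix.transpose_mul]

/-- `Cᴴ Ĉ + 2 N(P_L)`. -/
def outSource (L : ℕ) (T : LQO n m m) (R : LQO r m m) : Matrix (Fin n) (Fin r) ℂ :=
  T.Cᴴ * R.C + (2 : ℂ) • quadSource T.M R.M (finGramian L T R)

/-- The factor 2 cancels the ½ in N. The differential of h₂ produces M_k itself where the adjoint of
N has M_kᴴ; being Hermitian reconciles the two. -/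
theorem conjTranspose_two_smul_quadSource {p : ℕ} {M : Fin p → Matrix (Fin n) (Fin n) ℂ}
    (hM : ∀ k, (M k).IsHermitian) (M' : Fin p → Matrix (Fin r) (Fin r) ℂ)
    (P : Matrix (Fin n) (Fin r) ℂ) :
    ((2 : ℂ) • quadSource M M' P)ᴴ =
      ∑ k, ((M' k)ᴴ * Pᵀ * M k + (M' k)ᵀᴴ * Pᵀ * (M k)ᵀ) := by
  have hP : (P.map star)ᴴ = Pᵀ := by ext i j; simp
  rw [quadSource, smul_smul, mul_one_div_cancel two_ne_zero, one_smul, conjTranspose_sum]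
  refine Finset.sum_congr rfl fun k _ => ?_
  rw [conjTranspose_add, conjTranspose_mul, conjTranspose_mul, conjTranspose_mul,
    conjTranspose_mul, hP, (hM k).eq, (hM k).transpose.eq, Matrix.mul_assoc, Matrix.mul_assoc]

/-- The three terms are the product rule in the left input, M̂_k and the right input; the
superscript ᴴᵀ is entrywise conjugation. -/
theorem matInner_dKernel₂ (X : Matrix (Fin m) (Fin m) ℂ) (η d : FullParam r m) (t₁ t₂ : ℕ)
    (k : Fin m) :
    matInner X (dKernel₂ η d t₁ t₂ k) =
      matInner ((η.2.2.2 k)ᴴ * ((η.1 ^ t₂ * η.2.1)ᴴᵀ * Xᵀ)) (dInput η d t₁)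
      + matInner ((η.1 ^ t₂ * η.2.1)ᴴᵀ * Xᵀ * (η.1 ^ t₁ * η.2.1)ᴴ) (d.2.2.2 k)
      + matInner ((η.2.2.2 k)ᵀᴴ * ((η.1 ^ t₁ * η.2.1)ᴴᵀ * X)) (dInput η d t₂) := by
  rw [dKernel₂, matInner_add_right, matInner_mul_right, matInner_add_right]
  congr 1
  · congr 1
    · rw [matInner_mul_right, matInner_transpose, Matrix.transpose_mul, Matrix.transpose_mul]
      rfl
    · rw [matInner_mul_left, matInner_transpose, Matrix.transpose_mul, Matrix.transpose_mul]
      rfl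
  · rw [matInner_mul_left, conjTranspose_mul, Matrix.mul_assoc]
    rfl

theorem kernelPairing_eq (L : ℕ) {T : LQO n m m} (hT : ∀ k, (T.M k).IsHermitian)
    (η d : FullParam r m) :
    kernelPairing L T η d =
      (∑ t ∈ Finset.range L,
        matInner ((outSource L T (romLQO η))ᴴ * (T.A ^ t * T.B)) (dInput η d t))
      + matInner (T.C * finGramian L T (romLQO η)) d.2.2.1
      + ∑ k, matInner ((finGramian L T (romLQO η))ᵀ * T.M k * finGramian L T (romLQO η))
          (d.2.2.2 k) := by
  set R := romLQO η with hR
  set P := finGramian L T R with hP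
  have hPt : Pᵀ = ∑ t ∈ Finset.range L, (η.1 ^ t * η.2.1)ᴴᵀ * (T.A ^ t * T.B)ᵀ :=
    finGramian_transpose_eq_sum L T R
  have hPs : P = ∑ t ∈ Finset.range L, (T.A ^ t * T.B) * (η.1 ^ t * η.2.1)ᴴ :=
    finGramian_eq_sum L T R
  have h1 : ∑ t ∈ Finset.range L, matInner (T.C * (T.A ^ t * T.B)) (dKernel₁ η d t) =
      matInner (T.C * P) d.2.2.1 + ∑ t ∈ Finset.range L,
        matInner (η.2.2.1ᴴ * T.C * (T.A ^ t * T.B)) (dInput η d t) := by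
    simp only [dKernel₁, matInner_add_right, Finset.sum_add_distrib]
    congr 1
    · rw [hPs, Matrix.mul_sum, matInner_sum_left]
      refine Finset.sum_congr rfl fun t _ => ?_
      rw [matInner_mul_right, Matrix.mul_assoc]
    · refine Finset.sum_congr rfl fun t _ => ?_
      rw [matInner_mul_left, Matrix.mul_assoc]
  -- The differential sits at t₁, so the sum over t₂ is free and builds Pᵀ; `hB` is the same with
  -- the roles of t₁ and t₂ exchanged.
  have hA : ∀ t₁, ∑ t₂ ∈ Finset.range L, ∑ k, matInner ((η.2.2.2 k)ᴴ *
      ((η.1 ^ t₂ * η.2.1)ᴴᵀ * ((T.A ^ t₁ * T.B)ᵀ * (T.M k)ᵀ * (T.A ^ t₂ * T.B))ᵀ))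
        (dInput η d t₁) =
      matInner (∑ k, (η.2.2.2 k)ᴴ * Pᵀ * T.M k * (T.A ^ t₁ * T.B)) (dInput η d t₁) := by
    intro t₁
    rw [matInner_sum_left, Finset.sum_comm]
    refine Finset.sum_congr rfl fun k _ => ?_
    rw [← matInner_sum_left, hPt]
    congr 1
    simp only [Matrix.mul_sum, Matrix.sum_mul]
    refine Finset.sum_congr rfl fun t _ => ?_
    simp only [Matrix.transpose_mul, transpose_transpose, Matrix.mul_assoc]
  have hB : ∀ t₂, ∑ t₁ ∈ Finset.range L, ∑ k, matInner ((η.2.2.2 k)ᵀᴴ *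
      ((η.1 ^ t₁ * η.2.1)ᴴᵀ * ((T.A ^ t₁ * T.B)ᵀ * (T.M k)ᵀ * (T.A ^ t₂ * T.B))))
        (dInput η d t₂) =
      matInner (∑ k, (η.2.2.2 k)ᵀᴴ * Pᵀ * (T.M k)ᵀ * (T.A ^ t₂ * T.B)) (dInput η d t₂) := by
    intro t₂
    rw [matInner_sum_left, Finset.sum_comm]
    refine Finset.sum_congr rfl fun k _ => ?_
    rw [← matInner_sum_left, hPt]
    congr 1
    simp only [Matrix.mul_sum, Matrix.sum_mul]
    refine Finset.sum_congr rfl fun t _ => ?_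
    simp only [Matrix.mul_assoc]
  have hM : ∑ t₁ ∈ Finset.range L, ∑ t₂ ∈ Finset.range L, ∑ k,
      matInner ((η.1 ^ t₂ * η.2.1)ᴴᵀ * ((T.A ^ t₁ * T.B)ᵀ * (T.M k)ᵀ * (T.A ^ t₂ * T.B))ᵀ *
        (η.1 ^ t₁ * η.2.1)ᴴ) (d.2.2.2 k) =
      ∑ k, matInner (Pᵀ * T.M k * P) (d.2.2.2 k) := by
    have : ∀ k, matInner (Pᵀ * T.M k * P) (d.2.2.2 k) =
        ∑ t₁ ∈ Finset.range L, ∑ t₂ ∈ Finset.range L,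
        matInner ((η.1 ^ t₂ * η.2.1)ᴴᵀ * ((T.A ^ t₁ * T.B)ᵀ * (T.M k)ᵀ * (T.A ^ t₂ * T.B))ᵀ *
          (η.1 ^ t₁ * η.2.1)ᴴ) (d.2.2.2 k) := by
      intro k
      simp only [← matInner_sum_left]
      congr 1
      rw [hPt]
      nth_rewrite 1 [hPs]
      rw [Matrix.mul_sum]
      refine Finset.sum_congr rfl fun t₁ _ => ?_
      simp only [Matrix.sum_mul]
      refine Finset.sum_congr rfl fun t₂ _ => ?_
      simp only [Matrix.transpose_mul, transpose_transpose, Matrix.mul_assoc]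
    simp only [this]
    rw [Finset.sum_comm]
    simp only [Finset.sum_comm (s := Finset.univ)]
    rw [Finset.sum_comm]
  have hQ : ∀ t, (outSource L T R)ᴴ * (T.A ^ t * T.B) =
      η.2.2.1ᴴ * T.C * (T.A ^ t * T.B)
        + (∑ k, (η.2.2.2 k)ᴴ * Pᵀ * T.M k * (T.A ^ t * T.B)
          + ∑ k, (η.2.2.2 k)ᵀᴴ * Pᵀ * (T.M k)ᵀ * (T.A ^ t * T.B)) := by
    intro t
    rw [outSource, conjTranspose_add, conjTranspose_two_smul_quadSource hT, conjTranspose_mul,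
      conjTranspose_conjTranspose, Matrix.add_mul, Finset.sum_add_distrib, Matrix.add_mul,
      Matrix.sum_mul, Matrix.sum_mul]
    rfl
  rw [kernelPairing, h1]
  simp only [matInner_dKernel₂, Finset.sum_add_distrib, hA, hM, hQ, matInner_add_left]
  -- In these terms the differential sits at t₂, so the two time sums are interchanged to match the
  -- order in the goal.
  have hB' := Finset.sum_congr (rfl : Finset.range L = Finset.range L) fun t _ => hB t
  rw [Finset.sum_comm] at hB'
  rw [hB']
  ring

theorem sum_matInner_dInput (L : ℕ) (K : Matrix (Fin r) (Fin n) ℂ) (F : Matrix (Fin n) (Fin n) ℂ)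
    (B : Matrix (Fin n) (Fin m) ℂ) (η d : FullParam r m) :
    ∑ t ∈ Finset.range L, matInner (K * (F ^ t * B)) (dInput η d t) =
      matInner (pairSum η.1ᴴ K F (B * η.2.1ᴴ) L) d.1 + matInner (sylvSum η.1ᴴ K F L * B) d.2.1 := by
  rw [pairSum, sylvSum, Matrix.sum_mul, matInner_sum_left, matInner_sum_left,
    ← Finset.sum_add_distrib]
  refine Finset.sum_congr rfl fun t _ => ?_
  rw [dInput, matInner_add_right, matInner_powSum, matInner_mul_left, conjTranspose_pow, powSum]
  simp only [Matrix.mul_assoc]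

/-- The gradient of `kernelPairing` in closed form. -/
theorem kernelPairing_eq_fullInner (L : ℕ) {T : LQO n m m} (hT : ∀ k, (T.M k).IsHermitian)
    (η d : FullParam r m) :
    kernelPairing L T η d = fullInner
      (pairSum η.1ᴴ (outSource L T (romLQO η))ᴴ T.A (T.B * η.2.1ᴴ) L,
        sylvSum η.1ᴴ (outSource L T (romLQO η))ᴴ T.A L * T.B,
        T.C * finGramian L T (romLQO η),
        fun k => (finGramian L T (romLQO η))ᵀ * T.M k * finGramian L T (romLQO η)) d := by
  rw [kernelPairing_eq L hT, sum_matInner_dInput]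
  rfl

end Adjoint

/-! ### Closed form of the gradient -/

section ClosedForm

variable {n r m : ℕ}

theorem adjSum_eq_powSum (A X : Matrix (Fin r) (Fin r) ℂ) (L : ℕ) :
    adjSum A L X = powSum Aᴴ X L := rfl

/-- This is the origin of the combination Y_L + 2 Z_L in the B̂-gradient: the sum is linear in its
source Cᴴ Ĉ + 2N. -/
theorem sylvSum_outSource (L : ℕ) (T : LQO n m m) (R : LQO r m m) :
    sylvSum R.Aᴴ (outSource L T R)ᴴ T.A L =
      (sylvSum T.Aᴴ (T.Cᴴ * R.C) R.A L
        + (2 : ℂ) • sylvSum T.Aᴴ (quadSource T.M R.M (finGramian L T R)) R.A L)ᴴ := by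
  have : sylvSum T.Aᴴ (T.Cᴴ * R.C) R.A L
        + (2 : ℂ) • sylvSum T.Aᴴ (quadSource T.M R.M (finGramian L T R)) R.A L
      = sylvSum T.Aᴴ (outSource L T R) R.A L := by
    simp only [sylvSum, outSource, Finset.smul_sum, ← Finset.sum_add_distrib, Matrix.mul_add,
      Matrix.add_mul, Matrix.mul_smul, Matrix.smul_mul]
  rw [this, conjTranspose_sylvSum, conjTranspose_conjTranspose]

/-- The `Â`-part of the gradient of `kernelPairing` through the solutions of the infinite-horizon
equations. -/
theorem pairSum_outSource (L : ℕ) (T : LQO n m m) (R : LQO r m m)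
    {P Z Y₀ Z₀ P₀ N : Matrix (Fin n) (Fin r) ℂ}
    (hN : N = quadSource T.M R.M P₀) (hP₀ : P₀ = finGramian L T R)
    (hY₀ : Y₀ = sylvSum T.Aᴴ (T.Cᴴ * R.C) R.A L) (hZ₀ : Z₀ = sylvSum T.Aᴴ N R.A L)
    (hP : P = T.A * P * R.Aᴴ + T.B * R.Bᴴ) (hZ : Z = T.Aᴴ * Z * R.A + N) :
    pairSum R.Aᴴ (outSource L T R)ᴴ T.A (T.B * R.Bᴴ) L =
      (Y₀ + (2 : ℂ) • Z₀)ᴴ * T.A * P₀ + (Y₀ + Z₀)ᴴ * T.A * (P - P₀) + (Z - Z₀)ᴴ * T.A * P₀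
        - adjSum R.A L (R.B * T.Bᴴ * (T.A ^ L)ᴴ * Z + Pᴴ * (T.A ^ L)ᴴ * T.Cᴴ * R.C
            + Pᴴ * (T.A ^ L)ᴴ * N)ᴴ := by
  have hZ' : Zᴴ = R.Aᴴ * Zᴴ * T.A + Nᴴ := by
    nth_rewrite 1 [hZ]
    simp only [conjTranspose_add, conjTranspose_mul, conjTranspose_conjTranspose, Matrix.mul_assoc]
  have hY₀' : Y₀ᴴ = sylvSum R.Aᴴ (T.Cᴴ * R.C)ᴴ T.A L := by
    rw [hY₀, conjTranspose_sylvSum, conjTranspose_conjTranspose]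
  have hZ₀' : Z₀ᴴ = sylvSum R.Aᴴ Nᴴ T.A L := by
    rw [hZ₀, conjTranspose_sylvSum, conjTranspose_conjTranspose]
  have hQ : (outSource L T R)ᴴ = (T.Cᴴ * R.C)ᴴ + Nᴴ + Nᴴ := by
    rw [outSource, two_smul, ← hP₀, ← hN, conjTranspose_add, conjTranspose_add, add_assoc]
  -- The source is Cᴴ Ĉ + N + N: the first two summands are resummed through P, the last one through
  -- Z.
  rw [hQ, pairSum_add, pairSum_add, pairSum_eq_of_right _ hP]
  nth_rewrite 1 [pairSum_eq_of_right _ hP]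
  rw [pairSum_eq_of_left hZ', ← hY₀', ← hZ₀',
    show sylvSum T.A (T.B * R.Bᴴ) R.Aᴴ L = P₀ from hP₀.symm, adjSum_eq_powSum, two_smul]
  simp only [conjTranspose_add, powSum_add, conjTranspose_sub, conjTranspose_mul, conjTranspose_conjTranspose,
    Matrix.add_mul, Matrix.sub_mul, Matrix.mul_sub, Matrix.mul_assoc]
  abel

theorem isHermitian_quadSource {p : ℕ} {M : Fin p → Matrix (Fin r) (Fin r) ℂ}
    (hM : ∀ k, (M k).IsHermitian) {P : Matrix (Fin r) (Fin r) ℂ} (hP : P.IsHermitian) :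
    (quadSource M M P).IsHermitian := by
  have hP' : (P.map star).IsHermitian := by
    ext i j
    exact congrArg star (hP.apply i j)
  have h2 : star (1 / 2 : ℂ) = 1 / 2 := by simp
  unfold Matrix.IsHermitian
  rw [quadSource, conjTranspose_smul, conjTranspose_sum, h2]
  congr 1
  refine Finset.sum_congr rfl fun k _ => ?_
  rw [conjTranspose_add, conjTranspose_mul, conjTranspose_mul, conjTranspose_mul,
    conjTranspose_mul, hP'.eq, (hM k).eq, (hM k).transpose.eq, Matrix.mul_assoc, Matrix.mul_assoc]

theorem isHermitian_sylvSum (F : Matrix (Fin r) (Fin r) ℂ) {Q : Matrix (Fin r) (Fin r) ℂ}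
    (hQ : Q.IsHermitian) (L : ℕ) : (sylvSum Fᴴ Q F L).IsHermitian := by
  unfold Matrix.IsHermitian
  rw [conjTranspose_sylvSum, conjTranspose_conjTranspose, hQ.eq]

/-- The closed-form gradient, all blocks. -/
def Gramians.grad (W : Gramians n r) (L : ℕ) (S : LQO n m m) (R : LQO r m m) : FullParam r m :=
  (W.gradA L S R, W.gradB S R, W.gradC S R, W.gradM S R)

/-- `W` solves the Sylvester and Lyapunov equations, its finite-horizon components are the
finite sums, and `P̂` is Hermitian. -/
structure Gramians.IsCanonical (W : Gramians n r) (L : ℕ) (S : LQO n m m) (R : LQO r m m) :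
    Prop extends W.Solves L S R where
  PtL_eq_sum : W.PtL = finGramian L S R
  PhL_eq_sum : W.PhL = finGramian L R R
  YtL_eq_sum : W.YtL = sylvSum S.Aᴴ (S.Cᴴ * R.C) R.A L
  YhL_eq_sum : W.YhL = sylvSum R.Aᴴ (R.Cᴴ * R.C) R.A L
  ZtL_eq_sum : W.ZtL = sylvSum S.Aᴴ (quadSource S.M R.M W.PtL) R.A L
  ZhL_eq_sum : W.ZhL = sylvSum R.Aᴴ (quadSource R.M R.M W.PhL) R.A L
  isHermitian_Ph : W.Ph.IsHermitian
  isHermitian_ZbarR : W.ZbarR.IsHermitian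

/-- The adjoint formula at T = R minus that at T = S. At T = R it contains adjoints of Ŷ_L, Ẑ_L,
Z̄_{r,L} and P̂, all Hermitian, so they can be dropped as in the stated closed form. -/
theorem Gramians.IsCanonical.grad_inner {W : Gramians n r} {L : ℕ} {S : LQO n m m}
    {η : FullParam r m} (hW : W.IsCanonical L S (romLQO η)) (hS : ∀ k, (S.M k).IsHermitian)
    (hη : ∀ k, ((romLQO η).M k).IsHermitian) (d : FullParam r m) :
    2 * (kernelPairing L (romLQO η) η d - kernelPairing L S η d) =
      fullInner (W.grad L S (romLQO η)) d := by
  have hPhL : W.PhL.IsHermitian := by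
    have h := isHermitian_sylvSum (romLQO η).Aᴴ
      (isHermitian_mul_conjTranspose_self (romLQO η).B) L
    rw [conjTranspose_conjTranspose] at h
    rw [hW.PhL_eq_sum]
    exact h
  have hNh := isHermitian_quadSource hη hPhL
  have hYhL : W.YhL.IsHermitian := by
    rw [hW.YhL_eq_sum]
    exact isHermitian_sylvSum _ (isHermitian_conjTranspose_mul_self _) L
  have hZhL : W.ZhL.IsHermitian := by
    rw [hW.ZhL_eq_sum]
    exact isHermitian_sylvSum _ hNh L
  have hA : W.gradA L S (romLQO η) = (2 : ℂ) •
      (pairSum η.1ᴴ (outSource L (romLQO η) (romLQO η))ᴴ η.1 (η.2.1 * η.2.1ᴴ) L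
        - pairSum η.1ᴴ (outSource L S (romLQO η))ᴴ S.A (S.B * η.2.1ᴴ) L) := by
    have e1 := pairSum_outSource L S (romLQO η) rfl hW.PtL_eq_sum hW.YtL_eq_sum hW.ZtL_eq_sum
      hW.Pt_eq hW.Zbar_eq
    have e2 := pairSum_outSource L (romLQO η) (romLQO η) rfl hW.PhL_eq_sum hW.YhL_eq_sum
      hW.ZhL_eq_sum hW.Ph_eq hW.ZbarR_eq
    -- The same identity restated with the fields of `romLQO η` unfolded, so that it matches the
    -- goal syntactically.
    have e1' : pairSum η.1ᴴ (outSource L S (romLQO η))ᴴ S.A (S.B * η.2.1ᴴ) L = _ := e1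
    have e2' : pairSum η.1ᴴ (outSource L (romLQO η) (romLQO η))ᴴ η.1 (η.2.1 * η.2.1ᴴ) L = _ := e2
    rw [e1', e2', Gramians.gradA, Gramians.LL, Gramians.VL]
    congr 1
    simp only [adjSum_eq_powSum, conjTranspose_add, conjTranspose_sub, powSum_add, powSum_sub,
      two_smul, hYhL.eq, hZhL.eq, hW.isHermitian_ZbarR.eq, hW.isHermitian_Ph.eq]
    abel
  have hB : W.gradB S (romLQO η) = (2 : ℂ) •
      (sylvSum η.1ᴴ (outSource L (romLQO η) (romLQO η))ᴴ η.1 L * η.2.1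
        - sylvSum η.1ᴴ (outSource L S (romLQO η))ᴴ S.A L * S.B) := by
    have e1 := sylvSum_outSource L S (romLQO η)
    have e2 := sylvSum_outSource L (romLQO η) (romLQO η)
    rw [← hW.YtL_eq_sum, ← hW.PtL_eq_sum, ← hW.ZtL_eq_sum] at e1
    rw [← hW.YhL_eq_sum, ← hW.PhL_eq_sum, ← hW.ZhL_eq_sum] at e2
    have e1' : sylvSum η.1ᴴ (outSource L S (romLQO η))ᴴ S.A L = _ := e1
    have e2' : sylvSum η.1ᴴ (outSource L (romLQO η) (romLQO η))ᴴ η.1 L = _ := e2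
    rw [e1', e2', Gramians.gradB]
    simp only [two_smul, conjTranspose_add, hYhL.eq, hZhL.eq]
    rw [← sub_eq_neg_add]
    rfl
  have hC : W.gradC S (romLQO η) = (2 : ℂ) •
      (η.2.2.1 * finGramian L (romLQO η) (romLQO η) - S.C * finGramian L S (romLQO η)) := by
    rw [Gramians.gradC, hW.PtL_eq_sum, hW.PhL_eq_sum, ← sub_eq_neg_add]
    rfl
  have hM : ∀ k, W.gradM S (romLQO η) k = (2 : ℂ) •
      ((finGramian L (romLQO η) (romLQO η))ᵀ * η.2.2.2 k * finGramian L (romLQO η) (romLQO η)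
        - (finGramian L S (romLQO η))ᵀ * S.M k * finGramian L S (romLQO η)) := by
    intro k
    rw [Gramians.gradM, hW.PtL_eq_sum, hW.PhL_eq_sum, ← sub_eq_neg_add]
    rfl
  rw [kernelPairing_eq_fullInner L hη, kernelPairing_eq_fullInner L hS]
  simp only [fullInner, Gramians.grad, hA, hB, hC, hM, matInner_two_smul_left, matInner_sub_left,
    ← Finset.mul_sum, Finset.sum_sub_distrib]
  simp only [romLQO]
  ring

theorem exists_canonical_gramians (L : ℕ) (S : LQO n m m) (R : LQO r m m) {a : Fin n → ℂ}
    {b : Fin r → ℂ} (hS : S.A = diagonal a) (hR : R.A = diagonal b) (ha : IsStable S.A)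
    (hb : IsStable R.A) (hM : ∀ k, (R.M k).IsHermitian) :
    ∃ W : Gramians n r, W.IsCanonical L S R ∧
      ∀ W' : Gramians n r, W'.Solves L S R → W' = W := by
  have ha' : ∀ i, ‖a i‖ < 1 := (hS ▸ ha).norm_lt_one_of_diagonal
  have hb' : ∀ i, ‖b i‖ < 1 := (hR ▸ hb).norm_lt_one_of_diagonal
  have hstar : ∀ {k : ℕ} {c : Fin k → ℂ}, (∀ i, ‖c i‖ < 1) → ∀ i, ‖star c i‖ < 1 := by
    intro k c h i
    rw [Pi.star_apply, norm_star]
    exact h i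
  have hP : ∀ Q, ∃! X : Matrix (Fin n) (Fin r) ℂ, X = S.A * X * R.Aᴴ + Q := by
    rw [hS, hR, diagonal_conjTranspose]
    exact existsUnique_sylvester_diagonal ha' (hstar hb')
  have hPr : ∀ Q, ∃! X : Matrix (Fin r) (Fin r) ℂ, X = R.A * X * R.Aᴴ + Q := by
    rw [hR, diagonal_conjTranspose]
    exact existsUnique_sylvester_diagonal hb' (hstar hb')
  have hY : ∀ Q, ∃! X : Matrix (Fin n) (Fin r) ℂ, X = S.Aᴴ * X * R.A + Q := by
    rw [hS, hR, diagonal_conjTranspose]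
    exact existsUnique_sylvester_diagonal (hstar ha') hb'
  have hYr : ∀ Q, ∃! X : Matrix (Fin r) (Fin r) ℂ, X = R.Aᴴ * X * R.A + Q := by
    rw [hR, diagonal_conjTranspose]
    exact existsUnique_sylvester_diagonal (hstar hb') hb'
  have hPhL : (finGramian L R R).IsHermitian := by
    have h := isHermitian_sylvSum R.Aᴴ (isHermitian_mul_conjTranspose_self R.B) L
    rwa [conjTranspose_conjTranspose] at h
  obtain ⟨Pt, hPt, -⟩ := hP (S.B * R.Bᴴ)
  obtain ⟨Ph, hPh, -⟩ := hPr (R.B * R.Bᴴ)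
  obtain ⟨Zb, hZb, -⟩ := hY (quadSource S.M R.M (finGramian L S R))
  obtain ⟨Zr, hZr, -⟩ := hYr (quadSource R.M R.M (finGramian L R R))
  refine ⟨⟨Pt, Ph, finGramian L S R, finGramian L R R, sylvSum S.Aᴴ (S.Cᴴ * R.C) R.A L,
    sylvSum R.Aᴴ (R.Cᴴ * R.C) R.A L, sylvSum S.Aᴴ (quadSource S.M R.M (finGramian L S R)) R.A L,
    sylvSum R.Aᴴ (quadSource R.M R.M (finGramian L R R)) R.A L, Zb, Zr⟩, ?_, ?_⟩
  · refine ⟨⟨hPt, hPh, ?_, ?_, ?_, ?_, ?_, ?_, hZb, hZr⟩, rfl, rfl, rfl, rfl, rfl, rfl, ?_, ?_⟩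
    · refine (sylvSum_eq _ _ _ _).trans ?_
      simp only [finGramian, add_sub_assoc, Matrix.mul_assoc]
    · refine (sylvSum_eq _ _ _ _).trans ?_
      simp only [finGramian, add_sub_assoc, Matrix.mul_assoc]
    · refine (sylvSum_eq _ _ _ _).trans ?_
      simp only [conjTranspose_pow, add_sub_assoc, Matrix.mul_assoc]
    · refine (sylvSum_eq _ _ _ _).trans ?_
      simp only [conjTranspose_pow, add_sub_assoc, Matrix.mul_assoc]
    · refine (sylvSum_eq _ _ _ _).trans ?_
      simp only [conjTranspose_pow, add_sub_assoc, Matrix.mul_assoc]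
    · refine (sylvSum_eq _ _ _ _).trans ?_
      simp only [conjTranspose_pow, add_sub_assoc, Matrix.mul_assoc]
    -- The conjugate transpose of P̂ solves the same equation, hence equals P̂; likewise below for
    -- Z̄_{r,L}, whose source is Hermitian.
    · refine (hPr (R.B * R.Bᴴ)).unique ?_ hPh
      nth_rewrite 1 [hPh]
      simp only [conjTranspose_add, conjTranspose_mul, conjTranspose_conjTranspose,
        Matrix.mul_assoc]
    · refine (hYr (quadSource R.M R.M (finGramian L R R))).unique ?_ hZr
      nth_rewrite 1 [hZr]
      simp only [conjTranspose_add, conjTranspose_mul, conjTranspose_conjTranspose,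
        Matrix.mul_assoc, (isHermitian_quadSource hM hPhL).eq]
  · intro W' hW
    -- The finite Gramians are identified first because they enter the sources of the four
    -- Z-equations.
    have e3 : W'.PtL = finGramian L S R := by
      refine (hP _).unique (hW.PtL_eq.trans (add_sub_assoc _ _ _)) ?_
      refine (sylvSum_eq _ _ _ _).trans ?_
      simp only [finGramian, Matrix.mul_assoc]
    have e4 : W'.PhL = finGramian L R R := by
      refine (hPr _).unique (hW.PhL_eq.trans (add_sub_assoc _ _ _)) ?_
      refine (sylvSum_eq _ _ _ _).trans ?_
      simp only [finGramian, Matrix.mul_assoc]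
    have hZt := hW.ZtL_eq
    have hZh := hW.ZhL_eq
    have hZb' := hW.Zbar_eq
    have hZr' := hW.ZbarR_eq
    rw [e3] at hZt hZb'
    rw [e4] at hZh hZr'
    ext1
    · exact (hP _).unique hW.Pt_eq hPt
    · exact (hPr _).unique hW.Ph_eq hPh
    · exact e3
    · exact e4
    · refine (hY _).unique (hW.YtL_eq.trans (add_sub_assoc _ _ _)) ?_
      refine (sylvSum_eq _ _ _ _).trans ?_
      simp only [conjTranspose_pow, Matrix.mul_assoc]
    · refine (hYr _).unique (hW.YhL_eq.trans (add_sub_assoc _ _ _)) ?_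
      refine (sylvSum_eq _ _ _ _).trans ?_
      simp only [conjTranspose_pow, Matrix.mul_assoc]
    · refine (hY _).unique (hZt.trans (add_sub_assoc _ _ _)) ?_
      refine (sylvSum_eq _ _ _ _).trans ?_
      simp only [conjTranspose_pow]
    · refine (hYr _).unique (hZh.trans (add_sub_assoc _ _ _)) ?_
      refine (sylvSum_eq _ _ _ _).trans ?_
      simp only [conjTranspose_pow]
    · exact (hY _).unique hZb' hZb
    · exact (hYr _).unique hZr' hZr

end ClosedForm

/-! ### The objective -/

section Objective

attribute [local instance] Matrix.normedAddCommGroup Matrix.normedSpace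

variable {n r m : ℕ}

/-- The local matrix norm serves the proof only: `HasGradientWrt` depends on the topology alone, and
this norm induces the usual entrywise one. -/
theorem hasGradientWrt_fullParam {L : ℕ} {S : LQO n m m} {η : FullParam r m}
    {W : Gramians n r} (hW : W.IsCanonical L S (romLQO η)) (hS : ∀ k, (S.M k).IsHermitian)
    (hη : ∀ k, ((romLQO η).M k).IsHermitian) :
    HasGradientWrt fullInner (fun y : FullParam r m => S.errSq L (romLQO y))
      (W.grad L S (romLQO η)) η := by
  have hid : ∀ {ι κ : Type} [Fintype ι] [Fintype κ] (l : FullParam r m →L[ℝ] Matrix ι κ ℂ),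
      HasMatDeriv (fun y => l y) (fun d => l d) η := by
    intro ι κ _ _ l i j
    let e : FullParam r m →L[ℝ] ℂ :=
      { toFun := fun y => l y i j
        map_add' := fun y z => by simp
        map_smul' := fun c y => by simp
        cont := l.continuous.matrix_elem i j }
    exact ⟨e, fun _ => rfl, e.hasFDerivAt⟩
  let p₁ := ContinuousLinearMap.fst ℝ (Matrix (Fin r) (Fin r) ℂ) (Matrix (Fin r) (Fin m) ℂ ×
    Matrix (Fin m) (Fin r) ℂ × (Fin m → Matrix (Fin r) (Fin r) ℂ))
  let q₁ := ContinuousLinearMap.snd ℝ (Matrix (Fin r) (Fin r) ℂ) (Matrix (Fin r) (Fin m) ℂ ×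
    Matrix (Fin m) (Fin r) ℂ × (Fin m → Matrix (Fin r) (Fin r) ℂ))
  let p₂ := ContinuousLinearMap.fst ℝ (Matrix (Fin r) (Fin m) ℂ)
    (Matrix (Fin m) (Fin r) ℂ × (Fin m → Matrix (Fin r) (Fin r) ℂ))
  let q₂ := ContinuousLinearMap.snd ℝ (Matrix (Fin r) (Fin m) ℂ)
    (Matrix (Fin m) (Fin r) ℂ × (Fin m → Matrix (Fin r) (Fin r) ℂ))
  let p₃ := ContinuousLinearMap.fst ℝ (Matrix (Fin m) (Fin r) ℂ)
    (Fin m → Matrix (Fin r) (Fin r) ℂ)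
  let q₃ := ContinuousLinearMap.snd ℝ (Matrix (Fin m) (Fin r) ℂ)
    (Fin m → Matrix (Fin r) (Fin r) ℂ)
  have h := hasGradientWrt_errSq (η := fun y : FullParam r m => y) (η' := fun d => d) L S
    (hid p₁) (hid (p₂.comp q₁)) (hid (p₃.comp (q₂.comp q₁)))
    (fun k => hid ((ContinuousLinearMap.proj (R := ℝ)
      (φ := fun _ : Fin m => Matrix (Fin r) (Fin r) ℂ) k).comp (q₃.comp (q₂.comp q₁))))
  exact h.congr_right fun d => hW.grad_inner hS hη d

/-- `toFull` as a continuous linear map. -/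
def toFullL (r m : ℕ) : DiagParam r m →L[ℝ] FullParam r m where
  toFun := toFull
  map_add' x y := by simp [toFull]
  map_smul' c x := by simp [toFull]
  cont := (continuous_fst.matrix_diagonal).prodMk continuous_snd

/-- The pairing of a matrix with a diagonal one sees only its diagonal: `diag` is the adjoint of Λ̂
↦ diag Λ̂. -/
theorem diagInner_scaledDiagGrad (κ : ℝ) (g : FullParam r m) (d : DiagParam r m) :
    diagInner (scaledDiagGrad κ g) d = κ * fullInner g (toFull d) := by
  have h : vecInner (κ • diag g.1) d.1 = κ * matInner g.1 (diagonal d.1) := by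
    simp [vecInner, matInner, Matrix.trace, dotProduct, Finset.mul_sum, mul_diagonal, mul_add,
      mul_assoc]
  simp only [diagInner, scaledDiagGrad, fullInner, toFull, h, matInner_real_smul_left, mul_add,
    Finset.mul_sum]

theorem hasGradientWrt_weighted_err {L : ℕ} {S : LQO n m m} {g : FullParam r m}
    {θ : DiagParam r m}
    (h : HasGradientWrt fullInner (fun y : FullParam r m => S.errSq L (romLQO y)) g (toFull θ))
    (hne : S.errSq L (romLQO (toFull θ)) ≠ 0) (c : ℝ) :
    HasGradientWrt diagInner (fun y : DiagParam r m => c * S.err L (romLQO (toFull y)))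
      (scaledDiagGrad (c / (2 * √(S.errSq L (romLQO (toFull θ))))) g) θ := by
  have h' := HasGradientWrt.comp_clm (x := θ) (toFullL r m) h
  exact (h'.mul_sqrt hne c).congr_right fun d => (diagInner_scaledDiagGrad _ _ _).symm

/-- The weights do not depend on θ, and the terms of the other layers are unaffected by the update,
so all but one summand is constant. -/
theorem hasGradientWrt_objective_update {ξ c : ℕ} (D : DeepSSM ξ n m c) (L : ℕ) (b : ℝ)
    {r : Fin ξ → ℕ} (θ : ∀ i, DiagParam (r i) m) (i : Fin ξ) {g : DiagParam (r i) m}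
    (h : HasGradientWrt diagInner (fun y : DiagParam (r i) m =>
      D.weight L b i * (D.layer i).err L (romLQO (toFull y))) g (θ i)) :
    HasGradientWrt diagInner
      (fun y : DiagParam (r i) m => objective D L b (Function.update θ i y)) g (θ i) := by
  have hF : (fun y : DiagParam (r i) m => objective D L b (Function.update θ i y)) = fun y =>
      D.weight L b i * (D.layer i).err L (romLQO (toFull y)) +
        ∑ j ∈ Finset.univ.erase i, D.weight L b j * (D.layer j).err L (romLQO (toFull (θ j))) := by
    funext y
    rw [objective, ← Finset.add_sum_erase _ _ (Finset.mem_univ i), Function.update_self]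
    refine congrArg (_ + ·) (Finset.sum_congr rfl fun j hj => ?_)
    rw [Function.update_of_ne (Finset.ne_of_mem_erase hj)]
  rw [hF]
  exact h.add_const _

theorem hasGradientWrt_objective {ξ c : ℕ} (D : DeepSSM ξ n m c) (L : ℕ) (b : ℝ)
    {r : Fin ξ → ℕ} (θ : ∀ i, DiagParam (r i) m) {g : ∀ i, DiagParam (r i) m}
    (h : ∀ i, HasGradientWrt diagInner (fun y : DiagParam (r i) m =>
      D.weight L b i * (D.layer i).err L (romLQO (toFull y))) (g i) (θ i)) :
    HasGradientWrt (fun G d : (∀ i, DiagParam (r i) m) => ∑ i, diagInner (G i) (d i))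
      (fun η : (∀ i, DiagParam (r i) m) => objective D L b η) g θ := by
  have h' : ∀ i ∈ Finset.univ, HasGradientWrt (fun _ d : (∀ i, DiagParam (r i) m) =>
      diagInner (g i) (d i)) (fun y : (∀ i, DiagParam (r i) m) =>
        D.weight L b i * (D.layer i).err L (romLQO (toFull (y i)))) θ θ := fun i _ =>
    HasGradientWrt.comp_clm (x := θ)
      (ContinuousLinearMap.proj (R := ℝ) (φ := fun i => DiagParam (r i) m) i) (h i)
  exact (HasGradientWrt.sum h').congr_right fun _ => rfl

end Objective

end

theorem mainTheorem4 {ξ n m c : ℕ} (D : DeepSSM ξ n m c) (hε : 0 < D.ε)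
    (hD : ∀ i, IsStable (D.layer i).A) (L : ℕ) (b : ℝ) (r : Fin ξ → ℕ)
    (θ : ∀ i, DiagParam (r i) m)
    (hstable : ∀ i, IsStable (romLQO (toFull (θ i))).A)
    (hherm : ∀ i j, ((romLQO (toFull (θ i))).M j).IsHermitian) :
    ∃ g : ∀ i, FullParam (r i) m,
      -- `g i` is the gradient of the squared error of layer `i` in `(Â, B̂, Ĉ, M̂_j)`
      (∀ i, HasGradientWrt fullInner
        (fun η : FullParam (r i) m => (D.layer i).errSq L (romLQO η)) (g i) (toFull (θ i))) ∧
      -- closed form of `g i` through the unique solutions of the Sylvester/Lyapunov equations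
      (∀ i, ∃ W : Gramians n (r i),
        W.Solves L (D.layer i) (romLQO (toFull (θ i))) ∧
        (∀ W' : Gramians n (r i), W'.Solves L (D.layer i) (romLQO (toFull (θ i))) → W' = W) ∧
        g i = (W.gradA L (D.layer i) (romLQO (toFull (θ i))),
          W.gradB (D.layer i) (romLQO (toFull (θ i))),
          W.gradC (D.layer i) (romLQO (toFull (θ i))),
          W.gradM (D.layer i) (romLQO (toFull (θ i))))) ∧
      -- gradient of the objective in the parameters of layer `i`
      (∀ i, (D.layer i).errSq L (romLQO (toFull (θ i))) ≠ 0 →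
        HasGradientWrt diagInner
          (fun η : DiagParam (r i) m => objective D L b (Function.update θ i η))
          (scaledDiagGrad (D.weight L b i /
            (2 * Real.sqrt ((D.layer i).errSq L (romLQO (toFull (θ i)))))) (g i))
          (θ i)) ∧
      -- total differential of the objective in all the parameters jointly
      ((∀ i, (D.layer i).errSq L (romLQO (toFull (θ i))) ≠ 0) →
        HasGradientWrt (fun G d : (∀ i, DiagParam (r i) m) => ∑ i, diagInner (G i) (d i))
          (fun η : (∀ i, DiagParam (r i) m) => objective D L b η)
          (fun i => scaledDiagGrad (D.weight L b i /
            (2 * Real.sqrt ((D.layer i).errSq L (romLQO (toFull (θ i)))))) (g i))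
          θ) := by
  have hM : ∀ i k, ((D.layer i).M k).IsHermitian := fun i k =>
    isHermitian_conjTranspose_mul_self (D.U i k)
  -- The two `rfl` arguments express that both state matrices are diagonal by construction.
  choose W hW hWu using fun i => exists_canonical_gramians L (D.layer i)
    (romLQO (toFull (θ i))) rfl rfl (hD i) (hstable i) (hherm i)
  have hg := fun i => hasGradientWrt_fullParam (hW i) (hM i) (hherm i)
  exact ⟨fun i => (W i).grad L (D.layer i) (romLQO (toFull (θ i))), hg,
    fun i => ⟨W i, (hW i).toSolves, hWu i, rfl⟩,
    fun i hi => hasGradientWrt_objective_update D L b θ i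
      (hasGradientWrt_weighted_err (hg i) hi _),
    fun hne => hasGradientWrt_objective D L b θ fun i =>
      hasGradientWrt_weighted_err (hg i) (hne i) _⟩
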